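/- Let $\log$ denote the logarithm to base $2$. For a string $x\in\{0,1\}^N$ and a query string $s\in\bigcup_{k=1}^{N}\{0,1\}^k$ put $\chi(x;s)=1$ if $s$ occurs in $x$ as a substring (a block of consecutive letters), and $\chi(x;s)=0$ otherwise. The substring oracle of $x$ is the unitary transformation $|s\rangle|a\rangle\mapsto|s\rangle|a\oplus\chi(x;s)\rangle$. Suppose that only query strings $s$ with $|s|\le \log N-1-2\log\log N$ or $|s|\ge 3\log N$ may be used, that is, the queries of length strictly between these two values are forbidden. Then the bounded-error quantum query complexity of identifying the hidden string $x$ is $\Omega(N)$: for every $0\le\varepsilon<1/2$ there are $c>0$ and $N_0$ such that for all $N\ge N_0$, every quantum algorithm which, for every $x\in\{0,1\}^N$, outputs $x$ with probability at least $1-\varepsilon$ uses at least $cN$ queries. In particular, the same holds if the queries of the two boundary lengths are forbidden too. -/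

import Mathlib

open scoped ENNReal

noncomputable section

/-- Basis labels `(q, a, z)` of the registers of a quantum query algorithm: the query register,
the one-bit answer register and the work register (of arbitrary finite dimension `d`). -/
abbrev Label (Q : Type) (d : ℕ) : Type := Q × Bool × Fin d

/-- The state space: the Hilbert space with orthonormal basis `|q, a, z⟩`. -/
abbrev StateSpace (Q : Type) (d : ℕ) : Type := EuclideanSpace ℂ (Label Q d)

open Classical in
/-- The basis state `|q, a, z⟩`. -/
def ket {Q : Type} {d : ℕ} (b : Label Q d) : StateSpace Q d :=
  EuclideanSpace.single b (1 : ℂ)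

/-- The permutation `(q, a, z) ↦ (q, a ⊕ h q, z)` of the basis labels. -/
def oraclePerm {Q : Type} (d : ℕ) (h : Q → Bool) : Label Q d ≃ Label Q d :=
  Function.Involutive.toPerm (fun b => (b.1, xor b.2.1 (h b.1), b.2.2)) (by
    rintro ⟨q, a, z⟩
    simp)

/-- The oracle of `h : Q → Bool`, i.e. the unitary `|q, a, z⟩ ↦ |q, a ⊕ h q, z⟩`
(see `oracle_ket`). -/
def oracle {Q : Type} [Fintype Q] (d : ℕ) (h : Q → Bool) :
    StateSpace Q d ≃ₗᵢ[ℂ] StateSpace Q d :=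
  LinearIsometryEquiv.piLpCongrLeft 2 ℂ ℂ (oraclePerm d h)

theorem oracle_ket {Q : Type} [Fintype Q] {d : ℕ} (h : Q → Bool) (q : Q) (a : Bool)
    (z : Fin d) : oracle d h (ket (q, a, z)) = ket (q, xor a (h q), z) := by
  classical
  simp only [oracle, ket]
  convert LinearIsometryEquiv.piLpCongrLeft_single (p := 2) (𝕜 := ℂ) (oraclePerm d h)
    (q, a, z) (1 : ℂ) using 2
  rfl

/-- A quantum query algorithm with queries from the finite set `Q` and results in `R`: it starts
in a basis state and alternates fixed unitaries `U 0, U 1, …` with calls to the oracle; at the end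
the basis label is measured, and `output` turns the label into the result. Stopped after `T`
queries, it uses only `U 0, …, U T`. -/
structure QueryAlgorithm (Q R : Type) [Fintype Q] where
  workDim : ℕ
  start : Label Q workDim
  U : ℕ → (StateSpace Q workDim ≃ₗᵢ[ℂ] StateSpace Q workDim)
  output : Label Q workDim → R

namespace QueryAlgorithm

variable {Q R : Type} [Fintype Q]

/-- The state `U_T O U_{T-1} O ⋯ O U_0 |start⟩` after exactly `T` queries to the oracle `O` of
`h : Q → Bool`. -/
def state (A : QueryAlgorithm Q R) (h : Q → Bool) : ℕ → StateSpace Q A.workDim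
  | 0 => A.U 0 (ket A.start)
  | t + 1 => A.U (t + 1) (oracle A.workDim h (A.state h t))

open Classical in
/-- The probability that the algorithm outputs `r` after `T` queries to the oracle of `h`. -/
def outputProb (A : QueryAlgorithm Q R) (h : Q → Bool) (T : ℕ) (r : R) : ℝ :=
  ∑ b : Label Q A.workDim, if A.output b = r then ‖A.state h T b‖ ^ 2 else 0

/-- With `T` queries, `A` computes `f` with error at most `ε` on every input `x`, where the input
`x` is accessible only through the oracle of `q ↦ ζ x q`. -/
def Computes {S : Type} (A : QueryAlgorithm Q R) (ζ : S → Q → Bool) (f : S → R) (ε : ℝ)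
    (T : ℕ) : Prop :=
  ∀ x : S, 1 - ε ≤ A.outputProb (ζ x) T (f x)

end QueryAlgorithm

/-- The `ε`-error quantum query complexity of `f` in the query model `ζ`: the least number of
queries of an algorithm computing `f` with error at most `ε` (`⊤` if there is none). -/
def queryComplexity {S Q R : Type} [Fintype Q] (ζ : S → Q → Bool) (f : S → R) (ε : ℝ) : ℕ∞ :=
  sInf {n : ℕ∞ | ∃ T : ℕ, n = T ∧ ∃ A : QueryAlgorithm Q R, A.Computes ζ f ε T}

/-- Binary strings of length `n`. -/
abbrev BitString (n : ℕ) : Type := Fin n → Bool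

/-- `s` occurs in `x` as a block of consecutive letters. -/
def IsSubstring {k N : ℕ} (s : BitString k) (x : BitString N) : Prop :=
  ∃ (i : ℕ) (h : i + k ≤ N), ∀ j : Fin k, x ⟨i + j, by omega⟩ = s j

/-- Queries to a substring oracle for strings of length `N`: strings of length `1, …, N`. -/
abbrev SQuery (N : ℕ) : Type := (k : Finset.Icc 1 N) × BitString k

/-- The length of a query string. -/
def SQuery.length {N : ℕ} (q : SQuery N) : ℕ := q.1

open Classical in
/-- The answer `χ(x; q)` of the substring oracle `x` to the query `q`. -/
def substringAnswer {N : ℕ} (x : BitString N) (q : SQuery N) : Bool :=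
  decide (IsSubstring q.2 x)

/-- `log N - 1 - 2 log log N`, with logarithms to base 2. -/
def lowerLength (N : ℕ) : ℝ := Real.logb 2 N - 1 - 2 * Real.logb 2 (Real.logb 2 N)

/-- `3 log N`, with the logarithm to base 2. -/
def upperLength (N : ℕ) : ℝ := 3 * Real.logb 2 N

/-- The queries that remain available: those whose length is not strictly between
`log N - 1 - 2 log log N` and `3 log N`. -/
abbrev AllowedQuery (N : ℕ) : Type :=
  {q : SQuery N // (q.length : ℝ) ≤ lowerLength N ∨ upperLength N ≤ (q.length : ℝ)}

instance allowedQueryFintype (N : ℕ) : Fintype (AllowedQuery N) := Fintype.ofFinite _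

/-- The `ε`-error quantum query complexity of identifying (that is, computing the identity
function of) a hidden string of length `N` through a substring oracle that accepts only the
allowed queries. -/
def restrictedIdentificationComplexity (N : ℕ) (ε : ℝ) : ℕ∞ :=
  queryComplexity (fun (x : BitString N) (q : AllowedQuery N) => substringAnswer x q.1)
    (fun x => x) ε

end

noncomputable section

open Finset

/-! ### The hybrid argument: comparison with one fixed oracle -/

section Hybrid

variable {Q S R : Type} [Fintype Q]

/-! For a uniformly random hidden string, every allowed query has an almost certain answer: a short
string almost surely occurs, a long one almost surely does not. Let `g` give these answers; each
allowed query disagrees with `g` on at most a fraction `1/N²` of the inputs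
(`card_substringAnswer_ne_le`). By the hybrid argument, the run with the true oracle then stays
within mean squared distance `4T²/N²` of the run with `g` (`sum_norm_state_sub_sq_le`). The latter
does not depend on the input, so its success probabilities sum to at most 1 over all `2^N` inputs.
Hence `T` must be of order `N`. -/

theorem oracle_apply {d : ℕ} (h : Q → Bool) (ψ : StateSpace Q d) (b : Label Q d) :
    oracle d h ψ b = ψ (oraclePerm d h b) := by
  rfl

open Classical in
/-- Two oracles differ on `ψ` by at most four times the weight of `ψ` on the queries where they
disagree. -/
theorem norm_oracle_sub_oracle_sq_le {d : ℕ} (h g : Q → Bool) (ψ : StateSpace Q d) :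
    ‖oracle d h ψ - oracle d g ψ‖ ^ 2 ≤
      4 * ∑ b : Label Q d, if h b.1 ≠ g b.1 then ‖ψ b‖ ^ 2 else 0 := by
  set w : Label Q d → ℝ := fun b => if h b.1 ≠ g b.1 then ‖ψ b‖ ^ 2 else 0 with hw
  -- Both permutations fix the query register, so the set of disagreeing labels is preserved.
  have key : ∀ b : Label Q d, ‖(oracle d h ψ - oracle d g ψ) b‖ ^ 2 ≤
      2 * w (oraclePerm d h b) + 2 * w (oraclePerm d g b) := by
    rintro ⟨q, a, z⟩
    have hh : oraclePerm d h (q, a, z) = (q, xor a (h q), z) := rfl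
    have hg : oraclePerm d g (q, a, z) = (q, xor a (g q), z) := rfl
    rw [PiLp.sub_apply, oracle_apply, oracle_apply, hh, hg]
    simp only [hw]
    by_cases hq : h q = g q
    · simp [hq]
    · simp only [ne_eq, hq, not_false_eq_true, if_true]
      have h1 := norm_sub_le (ψ (q, xor a (h q), z)) (ψ (q, xor a (g q), z))
      have h2 := norm_nonneg (ψ (q, xor a (h q), z) - ψ (q, xor a (g q), z))
      nlinarith [sq_nonneg (‖ψ (q, xor a (h q), z)‖ - ‖ψ (q, xor a (g q), z)‖)]
  rw [EuclideanSpace.norm_sq_eq]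
  calc _ ≤ ∑ b : Label Q d, (2 * w (oraclePerm d h b) + 2 * w (oraclePerm d g b)) :=
        sum_le_sum fun b _ => key b
    _ = 4 * ∑ b, w b := by
        rw [sum_add_distrib, ← mul_sum, ← mul_sum, Equiv.sum_comp, Equiv.sum_comp]
        ring

namespace QueryAlgorithm

theorem norm_state (A : QueryAlgorithm Q R) (h : Q → Bool) (t : ℕ) : ‖A.state h t‖ = 1 := by
  induction t with
  | zero => simp [state, ket]
  | succ t ih => simpa [state] using ih

/-- Errors only add up, since unitaries preserve distance; each is measured on the run with `g`,
which is the same for all inputs. -/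
theorem norm_state_sub_le (A : QueryAlgorithm Q R) (h g : Q → Bool) (T : ℕ) :
    ‖A.state h T - A.state g T‖ ≤
      ∑ t ∈ range T, ‖oracle _ h (A.state g t) - oracle _ g (A.state g t)‖ := by
  induction T with
  | zero => simp [state]
  | succ T ih =>
    rw [sum_range_succ, state, state, ← map_sub, LinearIsometryEquiv.norm_map]
    calc _ ≤ ‖oracle _ h (A.state h T) - oracle _ h (A.state g T)‖ +
            ‖oracle _ h (A.state g T) - oracle _ g (A.state g T)‖ := norm_sub_le_norm_sub_add_norm_sub ..
      _ ≤ _ := by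
        rw [← map_sub, LinearIsometryEquiv.norm_map]
        gcongr

open Classical in
/-- If on every query all but a `δ`-fraction of the inputs answer like `g`, then after `T` queries
the state is on average close to the state of the run with oracle `g`. -/
theorem sum_norm_state_sub_sq_le [Fintype S] (A : QueryAlgorithm Q R) (ζ : S → Q → Bool)
    (g : Q → Bool) (δ : ℝ)
    (hδ : ∀ q, (#{x : S | ζ x q ≠ g q} : ℝ) ≤ δ * Fintype.card S) (T : ℕ) :
    ∑ x, ‖A.state (ζ x) T - A.state g T‖ ^ 2 ≤ 4 * T ^ 2 * δ * Fintype.card S := by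
  have step : ∀ t, ∑ x, ‖oracle _ (ζ x) (A.state g t) - oracle _ g (A.state g t)‖ ^ 2 ≤
      4 * (δ * Fintype.card S) := by
    intro t
    calc _ ≤ ∑ x : S, 4 * ∑ b, (if ζ x b.1 ≠ g b.1 then ‖A.state g t b‖ ^ 2 else 0) :=
          sum_le_sum fun x _ => norm_oracle_sub_oracle_sq_le _ _ _
      _ = 4 * ∑ b, (#{x : S | ζ x b.1 ≠ g b.1} : ℝ) * ‖A.state g t b‖ ^ 2 := by
          rw [← mul_sum, sum_comm]
          congr 1
          refine sum_congr rfl fun b _ => ?_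
          rw [← sum_filter, sum_const, nsmul_eq_mul]
      _ ≤ 4 * ∑ b, (δ * Fintype.card S) * ‖A.state g t b‖ ^ 2 := by
          gcongr with b
          exact hδ _
      _ = 4 * (δ * Fintype.card S) := by
          rw [← mul_sum, ← EuclideanSpace.norm_sq_eq, norm_state]
          ring
  calc _ ≤ ∑ x, (T : ℝ) * ∑ t ∈ range T,
          ‖oracle _ (ζ x) (A.state g t) - oracle _ g (A.state g t)‖ ^ 2 := by
        refine sum_le_sum fun x _ => ?_
        refine (pow_le_pow_left₀ (norm_nonneg _) (A.norm_state_sub_le (ζ x) g T) 2).trans ?_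
        simpa using sq_sum_le_card_mul_sum_sq (s := range T)
          (f := fun t => ‖oracle _ (ζ x) (A.state g t) - oracle _ g (A.state g t)‖)
    _ = T * ∑ t ∈ range T, ∑ x,
          ‖oracle _ (ζ x) (A.state g t) - oracle _ g (A.state g t)‖ ^ 2 := by
        rw [← mul_sum, sum_comm]
    _ ≤ T * ∑ t ∈ range T, 4 * (δ * Fintype.card S) := by
        gcongr with t
        exact step t
    _ = _ := by
        rw [sum_const, card_range, nsmul_eq_mul]
        ring

theorem outputProb_le (A : QueryAlgorithm Q R) (h g : Q → Bool) (T : ℕ) (r : R) :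
    A.outputProb h T r ≤ 2 * A.outputProb g T r + 2 * ‖A.state h T - A.state g T‖ ^ 2 := by
  classical
  rw [EuclideanSpace.norm_sq_eq, outputProb, outputProb, mul_sum, mul_sum, ← sum_add_distrib]
  refine sum_le_sum fun b _ => ?_
  split_ifs with hb
  · rw [PiLp.sub_apply]
    have h1 := norm_add_le (A.state g T b) (A.state h T b - A.state g T b)
    rw [add_sub_cancel] at h1
    have h2 := norm_nonneg (A.state h T b)
    nlinarith [sq_nonneg (‖A.state g T b‖ - ‖A.state h T b - A.state g T b‖)]
  · positivity

theorem sum_outputProb [Fintype R] (A : QueryAlgorithm Q R) (h : Q → Bool) (T : ℕ) :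
    ∑ r, A.outputProb h T r = 1 := by
  classical
  simp only [outputProb]
  rw [sum_comm]
  simp only [sum_ite_eq, mem_univ, if_true]
  rw [← EuclideanSpace.norm_sq_eq, norm_state]
  norm_num

open Classical in
-- The run with `g` has total success probability 1 over all candidates; any further success must
-- come from deviation from that run.
theorem Computes.card_le [Fintype S] {A : QueryAlgorithm Q S} {ζ : S → Q → Bool} {ε : ℝ} {T : ℕ}
    (hA : A.Computes ζ (fun x => x) ε T) (g : Q → Bool) (δ : ℝ)
    (hδ : ∀ q, (#{x : S | ζ x q ≠ g q} : ℝ) ≤ δ * Fintype.card S) :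
    (1 - ε) * Fintype.card S ≤ 2 + 8 * T ^ 2 * δ * Fintype.card S := by
  calc (1 - ε) * Fintype.card S = ∑ _x : S, (1 - ε) := by
        rw [sum_const, nsmul_eq_mul, card_univ, mul_comm]
    _ ≤ ∑ x : S, (2 * A.outputProb g T x + 2 * ‖A.state (ζ x) T - A.state g T‖ ^ 2) :=
        sum_le_sum fun x _ => (hA x).trans (A.outputProb_le _ g T x)
    _ = 2 + 2 * ∑ x : S, ‖A.state (ζ x) T - A.state g T‖ ^ 2 := by
        rw [sum_add_distrib, ← mul_sum, ← mul_sum, sum_outputProb, mul_one]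
    _ ≤ _ := by linarith [A.sum_norm_state_sub_sq_le ζ g δ hδ T]

end QueryAlgorithm

end Hybrid

/-! ### Counting strings that contain or avoid a pattern -/

section Counting

variable {k N : ℕ}

open Classical in
theorem card_window_eq_mul_le (s : BitString k) (i : ℕ) (hi : i + k ≤ N) :
    #{x : BitString N | ∀ j : Fin k, x ⟨i + j, by omega⟩ = s j} * 2 ^ k ≤ 2 ^ N := by
  -- Overwriting the window loses nothing, as its old content was `s`.
  let F : BitString N × BitString k → BitString N := fun p n =>
    if h : i ≤ n.1 ∧ n.1 < i + k then p.2 ⟨n.1 - i, by omega⟩ else p.1 n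
  have hcard : #(({x : BitString N | ∀ j : Fin k, x ⟨i + j, by omega⟩ = s j} : Finset _) ×ˢ
      (univ : Finset (BitString k))) ≤ #(univ : Finset (BitString N)) := by
    refine card_le_card_of_injOn F (fun _ _ => mem_coe.2 (mem_univ _)) ?_
    rintro ⟨x, r⟩ hx ⟨y, u⟩ hy hxy
    simp only [coe_product, Set.mem_prod, mem_coe, mem_filter, mem_univ, true_and, and_true]
      at hx hy
    have hF := fun n => congrFun hxy n
    refine Prod.ext (funext fun n => ?_) (funext fun j => ?_)
    · by_cases h : i ≤ n.1 ∧ n.1 < i + k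
      · have h1 := hx ⟨n.1 - i, by omega⟩
        have h2 := hy ⟨n.1 - i, by omega⟩
        have h3 : (⟨i + (n.1 - i), by omega⟩ : Fin N) = n := Fin.ext (by simp; omega)
        simp only [h3] at h1 h2
        simp only [h1, h2]
      · simpa [F, h] using hF n
    · have := hF ⟨i + j, by omega⟩
      simpa [F] using this
  simpa [card_product] using hcard

open Classical in
theorem card_isSubstring_mul_le (hk : 1 ≤ k) (s : BitString k) :
    #{x : BitString N | IsSubstring s x} * 2 ^ k ≤ N * 2 ^ N := by
  let B : ℕ → Finset (BitString N) := fun i =>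
    {x | ∃ h : i + k ≤ N, ∀ j : Fin k, x ⟨i + j, by omega⟩ = s j}
  have hsub : ({x : BitString N | IsSubstring s x} : Finset _) ⊆ (range N).biUnion B := by
    intro x hx
    obtain ⟨i, hi, h⟩ := (mem_filter.1 hx).2
    exact mem_biUnion.2 ⟨i, mem_range.2 (by omega), mem_filter.2 ⟨mem_univ _, hi, h⟩⟩
  have hB : ∀ i, #(B i) * 2 ^ k ≤ 2 ^ N := by
    intro i
    by_cases hi : i + k ≤ N
    · simpa [B, hi] using card_window_eq_mul_le s i hi
    · simp [B, hi]
  calc _ ≤ (∑ i ∈ range N, #(B i)) * 2 ^ k :=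
        Nat.mul_le_mul_right _ ((card_le_card hsub).trans card_biUnion_le)
    _ = ∑ i ∈ range N, #(B i) * 2 ^ k := sum_mul ..
    _ ≤ ∑ _i ∈ range N, 2 ^ N := sum_le_sum fun i _ => hB i
    _ = N * 2 ^ N := by simp

open Classical in
/-- A string avoiding `s` differs from `s` on each of the `N / k` disjoint blocks of length `k`. -/
theorem card_not_isSubstring_le (s : BitString k) :
    #{x : BitString N | ¬ IsSubstring s x} ≤ (2 ^ k - 1) ^ (N / k) * 2 ^ (N - k * (N / k)) := by
  have hm : k * (N / k) ≤ N := Nat.mul_div_le N k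
  have hb : ∀ b : Fin (N / k), k * b.1 + k ≤ N := fun b =>
    (Nat.mul_le_mul_left k b.2).trans hm
  let F : {x : BitString N // ¬ IsSubstring s x} →
      (Fin (N / k) → {r : BitString k // r ≠ s}) × BitString (N - k * (N / k)) := fun x =>
    (fun b => ⟨fun j => x.1 ⟨k * b.1 + j, by have := hb b; omega⟩,
      fun h => x.2 ⟨k * b.1, hb b, fun j => congrFun h j⟩⟩,
     fun j => x.1 ⟨k * (N / k) + j, by omega⟩)
  have hF : Function.Injective F := by
    intro x y hxy
    refine Subtype.ext (funext fun n => ?_)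
    by_cases hn : n.1 < k * (N / k)
    · have hk : 0 < k := Nat.pos_of_ne_zero (by rintro rfl; simp at hn)
      have h1 := congrFun (congrArg Prod.fst hxy) ⟨n.1 / k, Nat.div_lt_of_lt_mul hn⟩
      have h2 := congrFun (congrArg Subtype.val h1) ⟨n.1 % k, Nat.mod_lt _ hk⟩
      simpa [F, Nat.div_add_mod] using h2
    · have h1 := congrFun (congrArg Prod.snd hxy) ⟨n.1 - k * (N / k), by omega⟩
      have h2 : k * (N / k) + (n.1 - k * (N / k)) = n.1 := by omega
      simpa [F, h2] using h1
  have hcard := Fintype.card_le_of_injective F hF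
  rw [Fintype.card_subtype] at hcard
  have hne : Fintype.card {r : BitString k // r ≠ s} = 2 ^ k - 1 := by
    simp [Fintype.card_subtype_compl]
  simpa [hne] using hcard

end Counting

/-! ### Both kinds of query have exceptional fraction at most `1/N²` -/

section Estimates

variable {k N : ℕ}

theorem four_mul_le_two_pow (hk : 4 ≤ k) : 4 * k ≤ 2 ^ k := by
  induction k, hk using Nat.le_induction with
  | base => norm_num
  | succ n hn ih => rw [pow_succ]; omega

theorem four_le_logb (hN : 16 ≤ N) : 4 ≤ Real.logb 2 N := by
  rw [Real.le_logb_iff_rpow_le (by norm_num) (by positivity)]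
  norm_num
  exact_mod_cast hN

theorem two_pow_mul_le_of_le_lowerLength (hN : 16 ≤ N) (hk : (k : ℝ) ≤ lowerLength N) :
    (2 : ℝ) ^ k * (2 * Real.logb 2 N ^ 2) ≤ N := by
  have hL := four_le_logb hN
  have hL0 : 0 < Real.logb 2 N := by linarith
  have hN0 : (0 : ℝ) < N := by positivity
  have hlog : Real.logb 2 ((2 : ℝ) ^ k * (2 * Real.logb 2 N ^ 2)) =
      k + (1 + 2 * Real.logb 2 (Real.logb 2 N)) := by
    rw [Real.logb_mul (by positivity) (by positivity), Real.logb_mul (by norm_num) (by positivity),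
      Real.logb_pow, Real.logb_pow, Real.logb_self_eq_one (by norm_num)]
    push_cast
    ring
  rw [← Real.logb_le_logb (b := 2) (by norm_num) (by positivity) hN0, hlog]
  rw [lowerLength] at hk
  linarith

/-- The right side is the expected number of disjoint blocks equal to a given pattern; avoidance
then has probability at most `exp (-2 log N) = 1/N²`. -/
theorem two_mul_log_le_div_mul (hN : 16 ≤ N) (hk1 : 1 ≤ k) (hk : (k : ℝ) ≤ lowerLength N) :
    2 * Real.log N ≤ (N / k : ℕ) * (1 / 2 : ℝ) ^ k := by
  have hL := four_le_logb hN
  have hpow := two_pow_mul_le_of_le_lowerLength hN hk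
  set L := Real.logb 2 N with hLdef
  have hN0 : (0 : ℝ) < N := by positivity
  have hp0 : (0 : ℝ) < 2 ^ k := by positivity
  have hpN : (2 : ℝ) ^ k ≤ N :=
    (le_mul_of_one_le_right hp0.le (by nlinarith)).trans hpow
  have hkL : (k : ℝ) ≤ L := by
    rw [hLdef, Real.le_logb_iff_rpow_le (by norm_num) hN0, Real.rpow_natCast]
    exact hpN
  have h4k : 4 * k ≤ N := by
    by_cases h : 4 ≤ k
    · exact (four_mul_le_two_pow h).trans (by exact_mod_cast hpN)
    · omega
  -- The incomplete last block is shorter than `k ≤ N/4`.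
  have hmk : (3 / 4 : ℝ) * N ≤ (N / k : ℕ) * k := by
    have h1 := Nat.div_add_mod' N k
    have h2 := Nat.mod_lt N (show 0 < k by omega)
    have h3 : 3 * N ≤ 4 * (N / k * k) := by omega
    have h4 : (3 : ℝ) * N ≤ 4 * ((N / k : ℕ) * k) := by exact_mod_cast h3
    linarith
  have hm0 : (0 : ℝ) ≤ (N / k : ℕ) := by positivity
  have hlog : Real.log N = L * Real.log 2 := by
    rw [hLdef, Real.logb, div_mul_cancel₀ _ (by positivity)]
  have hinv : 2 * L ^ 2 / N ≤ (1 / 2 : ℝ) ^ k := by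
    rw [one_div, inv_pow, div_le_iff₀ hN0, ← div_eq_inv_mul, le_div_iff₀ hp0]
    linarith
  have hmL : (3 / 4 : ℝ) * N ≤ (N / k : ℕ) * L := hmk.trans (by gcongr)
  calc 2 * Real.log N ≤ 3 / 2 * L := by
        rw [hlog]
        nlinarith [Real.log_two_lt_d9]
    _ = (3 / 4 * N) * (2 * L / N) := by field_simp; norm_num
    _ ≤ ((N / k : ℕ) * L) * (2 * L / N) := by gcongr
    _ = (N / k : ℕ) * (2 * L ^ 2 / N) := by ring
    _ ≤ _ := by gcongr

open Classical in
theorem card_not_isSubstring_le_of_le_lowerLength (hN : 16 ≤ N) (hk1 : 1 ≤ k)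
    (hk : (k : ℝ) ≤ lowerLength N) (s : BitString k) :
    (#{x : BitString N | ¬ IsSubstring s x} : ℝ) ≤ 1 / (N : ℝ) ^ 2 * 2 ^ N := by
  have hN0 : (0 : ℝ) < N := by positivity
  have h := card_not_isSubstring_le (N := N) s
  have hm : k * (N / k) ≤ N := Nat.mul_div_le N k
  have hcast : ((2 ^ k - 1 : ℕ) : ℝ) = 2 ^ k * (1 - (1 / 2 : ℝ) ^ k) := by
    rw [Nat.cast_sub Nat.one_le_two_pow, mul_sub, ← mul_pow]
    norm_num
  have hhalf : (1 / 2 : ℝ) ^ k ≤ 1 := pow_le_one₀ (by norm_num) (by norm_num)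
  calc (#{x : BitString N | ¬ IsSubstring s x} : ℝ)
      ≤ ((2 ^ k - 1 : ℕ) : ℝ) ^ (N / k) * 2 ^ (N - k * (N / k)) := by exact_mod_cast h
    _ = (1 - (1 / 2 : ℝ) ^ k) ^ (N / k) * 2 ^ N := by
        rw [hcast, mul_pow, ← pow_mul, mul_comm ((2 : ℝ) ^ _), mul_assoc, ← pow_add,
          Nat.add_sub_cancel' hm]
    _ ≤ Real.exp (-(1 / 2 : ℝ) ^ k) ^ (N / k) * 2 ^ N := by
        gcongr ?_ * _
        exact pow_le_pow_left₀ (by linarith) (Real.one_sub_le_exp_neg _) _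
    _ = Real.exp (-((N / k : ℕ) * (1 / 2 : ℝ) ^ k)) * 2 ^ N := by
        rw [← Real.exp_nat_mul, mul_neg]
    _ ≤ Real.exp (-(2 * Real.log N)) * 2 ^ N := by
        gcongr ?_ * _
        exact Real.exp_le_exp.2 (neg_le_neg (two_mul_log_le_div_mul hN hk1 hk))
    _ = 1 / (N : ℝ) ^ 2 * 2 ^ N := by
        rw [Real.exp_neg, one_div, two_mul, Real.exp_add, Real.exp_log hN0, sq]

open Classical in
-- Union bound over at most `N` positions, each of probability `2^(-k) ≤ 1/N³`.
theorem card_isSubstring_le_of_upperLength_le (hN : 1 ≤ N) (hk1 : 1 ≤ k)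
    (hk : upperLength N ≤ k) (s : BitString k) :
    (#{x : BitString N | IsSubstring s x} : ℝ) ≤ 1 / (N : ℝ) ^ 2 * 2 ^ N := by
  have hN0 : (0 : ℝ) < N := by positivity
  have hpow : (N : ℝ) ^ 3 ≤ 2 ^ k := by
    rw [← Real.logb_le_logb (b := 2) (by norm_num) (by positivity) (by positivity),
      Real.logb_pow, Real.logb_pow, Real.logb_self_eq_one (by norm_num)]
    rw [upperLength] at hk
    push_cast
    linarith
  have h : (#{x : BitString N | IsSubstring s x} : ℝ) * 2 ^ k ≤ N * 2 ^ N := by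
    exact_mod_cast card_isSubstring_mul_le (N := N) hk1 s
  have h2 : (#{x : BitString N | IsSubstring s x} : ℝ) * (N : ℝ) ^ 3 ≤ N * 2 ^ N :=
    (mul_le_mul_of_nonneg_left hpow (by positivity)).trans h
  rw [one_div, ← div_eq_inv_mul, le_div_iff₀ (by positivity)]
  refine le_of_mul_le_mul_left ?_ hN0
  linarith

open Classical in
/-- The answers to the short queries are nearly always `1`, those to the long ones `0`. -/
theorem card_substringAnswer_ne_le (hN : 16 ≤ N) (q : AllowedQuery N) :
    (#{x : BitString N | substringAnswer x q.1 ≠ decide ((q.1.length : ℝ) ≤ lowerLength N)} : ℝ) ≤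
      1 / (N : ℝ) ^ 2 * Fintype.card (BitString N) := by
  obtain ⟨⟨⟨k, hkN⟩, s⟩, hq⟩ := q
  have hk1 : 1 ≤ k := (mem_Icc.1 hkN).1
  have hcard : (Fintype.card (BitString N) : ℝ) = 2 ^ N := by simp
  rw [hcard]
  simp only [SQuery.length, substringAnswer] at hq ⊢
  by_cases h : (k : ℝ) ≤ lowerLength N
  · simpa [h] using card_not_isSubstring_le_of_le_lowerLength hN hk1 h s
  · simpa [h] using
      card_isSubstring_le_of_upperLength_le (by omega) hk1 (hq.resolve_left h) s

end Estimates

end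

theorem theorem3 (ε : ℝ) (hε0 : 0 ≤ ε) (hε : ε < 1 / 2) :
    ∃ c : ℝ, 0 < c ∧ ∃ N₀ : ℕ, ∀ N : ℕ, N₀ ≤ N →
      ENNReal.ofReal (c * N) ≤ ((restrictedIdentificationComplexity N ε : ℕ∞) : ℝ≥0∞) := by
  classical
  -- If `T < N/6`, the deviation contributes at most `8/36 = 2/9` and guessing `2/2^N ≤ 1/4`;
  -- together these stay below `1/2 < 1 - ε`.
  refine ⟨1 / 6, by norm_num, 16, fun N hN => ?_⟩
  have hN0 : (0 : ℝ) < N := by positivity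
  have hT : ∀ T : ℕ, (∃ A : QueryAlgorithm (AllowedQuery N) (BitString N),
      A.Computes (fun x q => substringAnswer x q.1) (fun x => x) ε T) →
      1 / 6 * (N : ℝ) ≤ T := by
    rintro T ⟨A, hA⟩
    have h := hA.card_le (fun q => decide ((q.1.length : ℝ) ≤ lowerLength N)) _
      (card_substringAnswer_ne_le hN)
    have hcard : (Fintype.card (BitString N) : ℝ) = 2 ^ N := by simp
    rw [hcard] at h
    have h8 : (8 : ℝ) ≤ 2 ^ N := by
      calc (8 : ℝ) = 2 ^ 3 := by norm_num
        _ ≤ 2 ^ N := pow_le_pow_right₀ (by norm_num) (by omega)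
    by_contra! hlt
    have hsq : (T : ℝ) ^ 2 ≤ (1 / 6 * (N : ℝ)) ^ 2 := pow_le_pow_left₀ (by positivity) hlt.le 2
    have h9 : 8 * (T : ℝ) ^ 2 * (1 / (N : ℝ) ^ 2) ≤ 2 / 9 := by
      rw [mul_one_div, div_le_iff₀ (by positivity)]
      linarith
    nlinarith
  have hn : ((⌈1 / 6 * (N : ℝ)⌉₊ : ℕ) : ℕ∞) ≤ restrictedIdentificationComplexity N ε := by
    refine le_sInf ?_
    rintro n ⟨T, rfl, hA⟩
    exact_mod_cast Nat.ceil_le.2 (hT T hA)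
  calc ENNReal.ofReal (1 / 6 * N) ≤ ENNReal.ofReal (⌈1 / 6 * (N : ℝ)⌉₊ : ℝ) :=
        ENNReal.ofReal_le_ofReal (Nat.le_ceil _)
    _ = (((⌈1 / 6 * (N : ℝ)⌉₊ : ℕ) : ℕ∞) : ℝ≥0∞) := by simp
    _ ≤ _ := by exact_mod_cast hn
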